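/- Let $(q_k)_{k\in\mathbb Z}$ be a probability distribution on $\mathbb Z$, let $Z$ have distribution $(q_k)$, and assume $\mathbb E Z^+<\infty$ and $\mathbb P(Z<0)>0$. Let $\beta\in(0,1)$ and $\gamma\in(0,1)$. Consider the Markov decision process with state space $X=\mathbb Z$, action sets $A(x)=\{0,\dots,x\}$ for $x\ge 0$ and $A(x)=\{0\}$ for $x<0$, and the following transition law: from the state $x\ge 0$ under the action $a$ the next state is distributed as $x-a+Z$, and states $x<0$ are absorbing. Put $D=\{(x,a):x\in X,\ a\in A(x)\}$. A policy $\pi=(\pi_k)_{k\ge 0}$ is a sequence of maps assigning to each history $\omega_k=(x_0,a_0,\dots,a_{k-1},x_k)\in D^k\times X$ an action $\pi_k(\omega_k)\in A(x_k)$; $\Pi$ is the set of all policies, $\mathbb E_x^\pi$ is the expectation for the process $(x_k,a_k)_{k\ge 0}$ started at $x_0=x$ and controlled by $\pi$, and $\tau=\inf\{n\ge 0: x_n<0\}\in\mathbb N_0\cup\{\infty\}$ is the ruin time. For $x\in\mathbb Z$ and $y\ge 0$ let $$J_\pi(x,y)=\mathbb E_x^\pi\Big(\sum_{k=0}^{\tau-1}\beta^k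 a_k+y\Big)^\gamma,\qquad J(x,y)=\sup_{\pi\in\Pi}J_\pi(x,y).$$ For $x\ge 0$ and $y\ge 0$ let $f^*(x,y)$ be the largest $a\in A(x)$ that maximises $$a\mapsto \beta^\gamma\sum_{k\in\mathbb Z}J\Big(x-a+k,\frac{a+y}{\beta}\Big)q_k$$ over $A(x)$, and let $f^*(x,y)=0$ for $x<0$. For fixed $y\ge 0$ let $\pi^*$ be the history-dependent policy $\pi^*_k(\omega_k)=f^*(x_k,y_k)$, where $y_0=y$ and $y_k=\big(y_{k-1}+f^*(x_{k-1},y_{k-1})\big)/\beta$ for $k\ge 1$. Then, for every $x\in\mathbb Z$ and every $y\ge 0$, with $\pi^*$ generated from $y_0=y$, $$J(x,y)=J_{\pi^*}(x,y)<\infty.$$ -/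

import Mathlib

open MeasureTheory ProbabilityTheory
open scoped ENNReal NNReal

noncomputable section

namespace Dividend

/-- The finite set `A(x)` of admissible dividends: `{0, …, x}` for `x ≥ 0`, and `{0}` for `x < 0`
(where `x.toNat = 0`). -/
def actions (x : ℤ) : Finset ℕ := Finset.Iic x.toNat

/-- The set `D` of admissible pairs `(x, a)`, `a ∈ A(x)`. -/
abbrev AdmissiblePair : Type := {p : ℤ × ℕ // p.2 ∈ actions p.1}

/-- A feasible history `ω_k = (x_0, a_0, …, x_{k-1}, a_{k-1}, x_k) ∈ D^k × X` is a pair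
`(h, x)` with `h : Fin k → D` and `x = x_k`. A (history-dependent) policy assigns to every
feasible history an action admissible in the current state. -/
structure Policy where
  act : (k : ℕ) → (Fin k → AdmissiblePair) → ℤ → ℕ
  act_mem : ∀ (k : ℕ) (h : Fin k → AdmissiblePair) (x : ℤ), act k h x ∈ actions x

/-- The admissible pair `(x_k, π_k(ω_k))`. -/
def Policy.pair (π : Policy) (k : ℕ) (h : Fin k → AdmissiblePair) (x : ℤ) : AdmissiblePair :=
  ⟨(x, π.act k h x), π.act_mem k h x⟩

/-- The transition law `q(· | x, a)`: the law of `x - a + Z` if `x ≥ 0`, where `Z` has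
distribution `q`, and the point mass at `x` if `x < 0`. -/
def transition (q : PMF ℤ) (x : ℤ) (a : ℕ) : PMF ℤ :=
  if 0 ≤ x then q.map (fun z => x - (a : ℤ) + z) else PMF.pure x

/-- The conditional law of `(x_{n+1}, a_{n+1})` given `(x_0, a_0, …, x_n, a_n)` under `π`:
`x_{n+1}` is drawn from `q(· | x_n, a_n)` and `a_{n+1} = π_{n+1}(x_0, a_0, …, x_{n+1})`. -/
def stepKernel (q : PMF ℤ) (π : Policy) (n : ℕ) :
    Kernel ((i : Finset.Iic n) → (fun _ : ℕ => AdmissiblePair) i) AdmissiblePair :=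
  Kernel.ofFunOfCountable fun h =>
    ((transition q (h ⟨n, Finset.mem_Iic.2 le_rfl⟩).1.1
        (h ⟨n, Finset.mem_Iic.2 le_rfl⟩).1.2).map
      (π.pair (n + 1)
        (fun i => h ⟨(i : ℕ), Finset.mem_Iic.2 (Nat.lt_succ_iff.1 i.2)⟩))).toMeasure

instance (q : PMF ℤ) (π : Policy) (n : ℕ) : IsMarkovKernel (stepKernel q π n) :=
  ⟨fun _ => PMF.toMeasure.isProbabilityMeasure _⟩

/-- The measure `P_x^π` on `Ω_∞ = D^∞`, given by the Ionescu-Tulcea theorem. -/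
def pathMeasure (q : PMF ℤ) (π : Policy) (x : ℤ) : Measure (ℕ → AdmissiblePair) :=
  Kernel.traj (X := fun _ : ℕ => AdmissiblePair) (stepKernel q π) 0
    (fun _ => π.pair 0 Fin.elim0 x)

/-- The ruin time `τ = inf {n | x_n < 0}` (`⊤` if ruin never occurs). -/
def ruinTime (ω : ℕ → AdmissiblePair) : ℕ∞ :=
  ⨅ n ∈ {n : ℕ | (ω n).1.1 < 0}, (n : ℕ∞)

/-- The discounted dividends `∑_{k=0}^{τ-1} β^k a_k` paid until ruin. -/
def totalDividends (β : ℝ≥0) (ω : ℕ → AdmissiblePair) : ℝ≥0∞ :=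
  ∑' k : ℕ, if (k : ℕ∞) < ruinTime ω then (β : ℝ≥0∞) ^ k * ((ω k).1.2 : ℝ≥0∞) else 0

/-- `J_π(x, y) = E_x^π (∑_{k=0}^{τ-1} β^k a_k + y)^γ`. -/
def policyValue (q : PMF ℤ) (β : ℝ≥0) (γ : ℝ) (π : Policy) (x : ℤ) (y : ℝ≥0) : ℝ≥0∞ :=
  ∫⁻ ω, (totalDividends β ω + (y : ℝ≥0∞)) ^ γ ∂(pathMeasure q π x)

/-- `J(x, y) = sup_π J_π(x, y)`. -/
def value (q : PMF ℤ) (β : ℝ≥0) (γ : ℝ) (x : ℤ) (y : ℝ≥0) : ℝ≥0∞ :=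
  ⨆ π : Policy, policyValue q β γ π x y

/-- `G(x, y) = ∑_k J(x + k, y) q_k`. -/
def continuationValue (q : PMF ℤ) (β : ℝ≥0) (γ : ℝ) (x : ℤ) (y : ℝ≥0) : ℝ≥0∞ :=
  ∑' k : ℤ, value q β γ (x + k) y * q k

/-- The expression `β^γ G(x - a, (a + y) / β)` maximised over `a ∈ A(x)`. -/
def objective (q : PMF ℤ) (β : ℝ≥0) (γ : ℝ) (x : ℤ) (y : ℝ≥0) (a : ℕ) : ℝ≥0∞ :=
  (β : ℝ≥0∞) ^ γ * continuationValue q β γ (x - (a : ℤ)) (((a : ℝ≥0) + y) / β)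

/-- The set of maximisers of the objective over `A(x)`. -/
def maximisers (q : PMF ℤ) (β : ℝ≥0) (γ : ℝ) (x : ℤ) (y : ℝ≥0) : Set ℕ :=
  {a | a ∈ actions x ∧ ∀ b ∈ actions x, objective q β γ x y b ≤ objective q β γ x y a}

/-- The largest maximiser `f^*(x, y)`; it is `0` for `x < 0`. -/
def largestMaximiser (q : PMF ℤ) (β : ℝ≥0) (γ : ℝ) (x : ℤ) (y : ℝ≥0) : ℕ :=
  if 0 ≤ x then sSup (maximisers q β γ x y) else 0

/-- The largest maximiser exists. -/
theorem isGreatest_largestMaximiser (q : PMF ℤ) (β : ℝ≥0) (γ : ℝ) {x : ℤ} (hx : 0 ≤ x)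
    (y : ℝ≥0) : IsGreatest (maximisers q β γ x y) (largestMaximiser q β γ x y) := by
  have hne : (maximisers q β γ x y).Nonempty := by
    obtain ⟨a, ha, h⟩ := Finset.exists_max_image (actions x) (objective q β γ x y)
      ⟨0, by simp [actions]⟩
    exact ⟨a, ha, h⟩
  have hbdd : BddAbove (maximisers q β γ x y) :=
    ⟨x.toNat, fun a ha => by simpa [actions] using ha.1⟩
  rw [largestMaximiser, if_pos hx]
  exact ⟨Nat.sSup_mem hne hbdd, fun a ha => le_csSup hbdd ha⟩

theorem largestMaximiser_mem (q : PMF ℤ) (β : ℝ≥0) (γ : ℝ) (x : ℤ) (y : ℝ≥0) :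
    largestMaximiser q β γ x y ∈ actions x := by
  by_cases hx : 0 ≤ x
  · exact (isGreatest_largestMaximiser q β γ hx y).1.1
  · simp [largestMaximiser, hx, actions]

/-- The sequence `y_0 = y`, `y_k = (y_{k-1} + f^*(x_{k-1}, y_{k-1})) / β` along a history. -/
def accumulated (q : PMF ℤ) (β : ℝ≥0) (γ : ℝ) (y : ℝ≥0) :
    (k : ℕ) → (Fin k → AdmissiblePair) → ℝ≥0
  | 0, _ => y
  | k + 1, h =>
    (accumulated q β γ y k (fun i => h i.castSucc) +
      (largestMaximiser q β γ (h (Fin.last k)).1.1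
        (accumulated q β γ y k (fun i => h i.castSucc)) : ℝ≥0)) / β

/-- The policy `π^*` with `π^*_k(ω_k) = f^*(x_k, y_k)` and `y_0 = y`. -/
def optimalPolicy (q : PMF ℤ) (β : ℝ≥0) (γ : ℝ) (y : ℝ≥0) : Policy where
  act k h x := largestMaximiser q β γ x (accumulated q β γ y k h)
  act_mem _ _ _ := largestMaximiser_mem q β γ _ _

end Dividend

end

namespace Dividend

/-! Only the Bellman inequality is needed, not the Bellman equation. Conditioning on the first step
gives `J ≤ β^γ G(x - a, (a + y)/β)` at the greedy action `a`
(`value_le_objective_largestMaximiser`), while the value of `π^*` satisfies the same recursion with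
equality, because `π^*` after one step is again greedy, started from `(a + y)/β`
(`optimalPolicy_shift`).

The gap between the two is bounded by a function of `x` alone. Subadditivity of `t ↦ t^γ` and a
uniform first-moment bound on the dividends give `J(x, y) ≤ y^γ + x⁺ + L`, and every policy earns at
least `y^γ`, so the gap is at most `x⁺ + L`. One step multiplies this bound by some `r` with `β^γ <
r < 1`, once `L` is large enough to absorb `E Z⁺` (`value_le_policyValue_add`). Iterating, the gap
is at most `r^n (x⁺ + L)`, which tends to `0`.

The recursions rest on the Markov property at time one (`pathMeasure_eq_sum`), proved by comparing
cylinder probabilities. -/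

/-! ### Cylinder probabilities of the path measure. -/

/-- The paths that agree with `g` up to time `n`. -/
def cylinderUpTo (n : ℕ) (g : ℕ → AdmissiblePair) : Set (ℕ → AdmissiblePair) :=
  {ω | ∀ i ≤ n, ω i = g i}

theorem cylinderUpTo_eq_preimage (n : ℕ) (g : ℕ → AdmissiblePair) :
    cylinderUpTo n g = Preorder.frestrictLe (π := fun _ : ℕ => AdmissiblePair) n ⁻¹'
      {Preorder.frestrictLe (π := fun _ : ℕ => AdmissiblePair) n g} := by
  ext ω
  simp only [cylinderUpTo, Set.mem_ofPred_eq, Set.mem_preimage, Set.mem_singleton_iff, funext_iff]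
  exact ⟨fun h i => h i (Finset.mem_Iic.1 i.2), fun h i hi => h ⟨i, Finset.mem_Iic.2 hi⟩⟩

theorem measurableSet_cylinderUpTo (n : ℕ) (g : ℕ → AdmissiblePair) :
    MeasurableSet (cylinderUpTo n g) := by
  rw [cylinderUpTo_eq_preimage]
  exact Preorder.measurable_frestrictLe n (measurableSet_singleton _)

theorem cylinderUpTo_succ (n : ℕ) (g : ℕ → AdmissiblePair) :
    cylinderUpTo (n + 1) g = cylinderUpTo n g ∩ {ω | ω (n + 1) = g (n + 1)} := by
  ext ω
  simp only [cylinderUpTo, Set.mem_ofPred_eq, Set.mem_inter_iff]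
  refine ⟨fun h => ⟨fun i hi => h i (by omega), h _ le_rfl⟩, fun h i hi => ?_⟩
  rcases Nat.le_succ_iff.1 hi with hi | rfl
  exacts [h.1 i hi, h.2]

/-- A finite measure on the path space is determined by its values on cylinders. -/
theorem measure_ext_of_cylinderUpTo {μ ν : Measure (ℕ → AdmissiblePair)} [IsFiniteMeasure μ]
    [IsFiniteMeasure ν] (h : ∀ n g, μ (cylinderUpTo n g) = ν (cylinderUpTo n g)) : μ = ν := by
  have key : ∀ n : ℕ, μ.map (Preorder.frestrictLe (π := fun _ : ℕ => AdmissiblePair) n) =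
      ν.map (Preorder.frestrictLe (π := fun _ : ℕ => AdmissiblePair) n) := by
    intro n
    refine Measure.ext_of_singleton fun s => ?_
    rw [Measure.map_apply (Preorder.measurable_frestrictLe n) (measurableSet_singleton _),
      Measure.map_apply (Preorder.measurable_frestrictLe n) (measurableSet_singleton _)]
    obtain ⟨g, rfl⟩ : ∃ g, Preorder.frestrictLe (π := fun _ : ℕ => AdmissiblePair) n g = s := by
      refine ⟨fun i => if hi : i ≤ n then s ⟨i, Finset.mem_Iic.2 hi⟩ else
        ⟨(0, 0), by simp [actions]⟩, ?_⟩
      ext1 i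
      have := Finset.mem_Iic.1 i.2
      simp [this]
    rw [← cylinderUpTo_eq_preimage]
    exact h n g
  -- Every finite set of times lies in an initial segment, so all finite-dimensional marginals
  -- agree.
  have hproj : ∀ I : Finset ℕ, μ.map I.restrict = ν.map I.restrict := by
    intro I
    have hI : I ⊆ Finset.Iic (I.sup id) := I.subset_Iic_sup_id
    have hcomp : (I.restrict : (ℕ → AdmissiblePair) → _) =
        Finset.restrict₂ (π := fun _ : ℕ => AdmissiblePair) hI ∘
          Preorder.frestrictLe (π := fun _ : ℕ => AdmissiblePair) (I.sup id) := rfl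
    rw [hcomp, ← Measure.map_map (Finset.measurable_restrict₂ _)
      (Preorder.measurable_frestrictLe _), key, Measure.map_map (Finset.measurable_restrict₂ _)
      (Preorder.measurable_frestrictLe _)]
  exact IsProjectiveLimit.unique (P := fun I : Finset ℕ => ν.map I.restrict) hproj (fun _ => rfl)

/-- The probability that the step from time `n` to `n + 1` follows `g`. -/
noncomputable def stepProb (q : PMF ℤ) (π : Policy) (n : ℕ) (g : ℕ → AdmissiblePair) : ℝ≥0∞ :=
  ∑' z : ℤ, transition q (g n).1.1 (g n).1.2 z *
    if g (n + 1) = π.pair (n + 1) (fun i => g i) z then 1 else 0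

theorem stepKernel_singleton (q : PMF ℤ) (π : Policy) (n : ℕ) (g : ℕ → AdmissiblePair) :
    stepKernel q π n (Preorder.frestrictLe (π := fun _ : ℕ => AdmissiblePair) n g) {g (n + 1)} =
      stepProb q π n g := by
  change (PMF.toMeasure _) _ = _
  rw [PMF.toMeasure_apply_singleton _ _ (measurableSet_singleton _), PMF.map_apply, stepProb]
  refine tsum_congr fun z => ?_
  rw [mul_ite, mul_one, mul_zero]
  convert rfl using 2
  exacts [Iff.rfl, rfl]

instance (q : PMF ℤ) (π : Policy) (x : ℤ) : IsProbabilityMeasure (pathMeasure q π x) := by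
  unfold pathMeasure; infer_instance

theorem map_frestrictLe_pathMeasure (q : PMF ℤ) (π : Policy) (x : ℤ) (n : ℕ) :
    (pathMeasure q π x).map (Preorder.frestrictLe (π := fun _ : ℕ => AdmissiblePair) n) =
      Kernel.partialTraj (X := fun _ : ℕ => AdmissiblePair) (stepKernel q π) 0 n
        (fun _ => π.pair 0 Fin.elim0 x) :=
  Kernel.traj_map_frestrictLe_apply _ _ _

theorem pathMeasure_cylinderUpTo_zero (q : PMF ℤ) (π : Policy) (x : ℤ) (g : ℕ → AdmissiblePair) :
    pathMeasure q π x (cylinderUpTo 0 g) = if g 0 = π.pair 0 Fin.elim0 x then 1 else 0 := by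
  rw [cylinderUpTo_eq_preimage, ← Measure.map_apply (Preorder.measurable_frestrictLe _)
    (measurableSet_singleton _), map_frestrictLe_pathMeasure, Kernel.partialTraj_self,
    Kernel.id_apply, Measure.dirac_apply' _ (measurableSet_singleton _), Set.indicator_apply]
  refine if_congr ?_ rfl rfl
  rw [Set.mem_singleton_iff, funext_iff]
  refine ⟨fun h => (h ⟨0, by simp⟩).symm, fun h i => ?_⟩
  have hi : (i : ℕ) = 0 := Nat.le_zero.1 (Finset.mem_Iic.1 i.2)
  change _ = g i
  rw [hi, h]

/-- Split the trajectory at time `n`: given its past, the continuation keeps that past almost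
surely, so only the single history `G` contributes, with weight `stepProb`. -/
theorem pathMeasure_cylinderUpTo_succ (q : PMF ℤ) (π : Policy) (x : ℤ) (n : ℕ)
    (g : ℕ → AdmissiblePair) :
    pathMeasure q π x (cylinderUpTo (n + 1) g) =
      pathMeasure q π x (cylinderUpTo n g) * stepProb q π n g := by
  set x₀ : (i : Finset.Iic 0) → (fun _ : ℕ => AdmissiblePair) i :=
    fun _ => π.pair 0 Fin.elim0 x
  have hpath : pathMeasure q π x = Measure.bind
      (Kernel.partialTraj (X := fun _ : ℕ => AdmissiblePair) (stepKernel q π) 0 n x₀)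
      (Kernel.traj (X := fun _ : ℕ => AdmissiblePair) (stepKernel q π) n) := by
    rw [← Kernel.comp_apply, Kernel.traj_comp_partialTraj (Nat.zero_le n)]
    rfl
  set G := Preorder.frestrictLe (π := fun _ : ℕ => AdmissiblePair) n g
  have hker : ∀ h, Kernel.traj (X := fun _ : ℕ => AdmissiblePair) (stepKernel q π) n h
      (cylinderUpTo (n + 1) g) =
      ({G} : Set _).indicator (fun _ => stepProb q π n g) h := by
    intro h
    have hdet : (Kernel.traj (X := fun _ : ℕ => AdmissiblePair) (stepKernel q π) n h)
        (cylinderUpTo n g) = ({G} : Set _).indicator 1 h := by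
      rw [cylinderUpTo_eq_preimage, ← Measure.map_apply (Preorder.measurable_frestrictLe _)
        (measurableSet_singleton _), Kernel.traj_map_frestrictLe_apply, Kernel.partialTraj_self,
        Kernel.id_apply, Measure.dirac_apply' _ (measurableSet_singleton _)]
    by_cases hh : h = G
    · subst hh
      rw [Set.indicator_of_mem (Set.mem_singleton _)] at hdet ⊢
      have hnull : Kernel.traj (X := fun _ : ℕ => AdmissiblePair) (stepKernel q π) n G
          (cylinderUpTo n g)ᶜ = 0 :=
        (prob_compl_eq_zero_iff (measurableSet_cylinderUpTo n g)).2 hdet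
      rw [cylinderUpTo_succ, Set.inter_comm, measure_inter_conull hnull, ← stepKernel_singleton, ← Kernel.map_traj_succ_self
          (X := fun _ : ℕ => AdmissiblePair) (κ := stepKernel q π),
        Kernel.map_apply' _ (measurable_pi_apply (n + 1)) _ (measurableSet_singleton _)]
      rfl
    · have hh' : h ∉ ({G} : Set _) := hh
      rw [Set.indicator_of_notMem hh'] at hdet ⊢
      exact measure_mono_null (by rw [cylinderUpTo_succ]; exact Set.inter_subset_left) hdet
  rw [show pathMeasure q π x (cylinderUpTo n g) =
      Kernel.partialTraj (X := fun _ : ℕ => AdmissiblePair) (stepKernel q π) 0 n x₀ {G} by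
    rw [cylinderUpTo_eq_preimage, ← Measure.map_apply (Preorder.measurable_frestrictLe _)
      (measurableSet_singleton _), map_frestrictLe_pathMeasure]]
  conv_lhs => rw [hpath, Measure.bind_apply (measurableSet_cylinderUpTo _ _)
    (Kernel.measurable _).aemeasurable]
  simp_rw [hker]
  rw [lintegral_indicator_const (measurableSet_singleton _), mul_comm]

theorem pathMeasure_cylinderUpTo (q : PMF ℤ) (π : Policy) (x : ℤ) (n : ℕ)
    (g : ℕ → AdmissiblePair) :
    pathMeasure q π x (cylinderUpTo n g) =
      (if g 0 = π.pair 0 Fin.elim0 x then 1 else 0) *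
        ∏ i ∈ Finset.range n, stepProb q π i g := by
  induction n with
  | zero => rw [pathMeasure_cylinderUpTo_zero, Finset.prod_range_zero, mul_one]
  | succ n ih => rw [pathMeasure_cylinderUpTo_succ, ih, Finset.prod_range_succ, mul_assoc]

/-! ### Shifted policies and the Markov property. -/

/-- The policy followed after the first state-action pair `p`. -/
def Policy.shift (π : Policy) (p : AdmissiblePair) : Policy where
  act k h x := π.act (k + 1) (Fin.cons p h) x
  act_mem k h x := π.act_mem (k + 1) (Fin.cons p h) x

/-- The path with first pair `p`, followed by `ω`. -/
def consPath (p : AdmissiblePair) (ω : ℕ → AdmissiblePair) : ℕ → AdmissiblePair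
  | 0 => p
  | n + 1 => ω n

theorem measurable_consPath (p : AdmissiblePair) : Measurable (consPath p) := by
  refine measurable_pi_lambda _ fun n => ?_
  cases n with
  | zero => exact measurable_const
  | succ n => exact measurable_pi_apply n

theorem stepProb_shift (q : PMF ℤ) (π : Policy) (n : ℕ) (g : ℕ → AdmissiblePair) :
    stepProb q (π.shift (g 0)) n (fun i => g (i + 1)) = stepProb q π (n + 1) g := by
  unfold stepProb
  refine tsum_congr fun z => ?_
  have : (Fin.cons (g 0) (fun i : Fin (n + 1) => g (i + 1)) : Fin (n + 2) → AdmissiblePair) =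
      fun i : Fin (n + 2) => g i := by
    funext i
    refine Fin.cases ?_ (fun j => ?_) i <;> simp
  have hp : (π.shift (g 0)).pair (n + 1) (fun i => g (i + 1)) z =
      π.pair (n + 1 + 1) (fun i => g i) z := by
    unfold Policy.pair Policy.shift
    simp only [this]
  rw [hp]

theorem preimage_consPath_zero (p : AdmissiblePair) (g : ℕ → AdmissiblePair) :
    consPath p ⁻¹' cylinderUpTo 0 g = if g 0 = p then Set.univ else ∅ := by
  ext ω
  split_ifs with h <;> simp [cylinderUpTo, consPath, h, eq_comm]

theorem preimage_consPath_succ (p : AdmissiblePair) (n : ℕ) (g : ℕ → AdmissiblePair) :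
    consPath p ⁻¹' cylinderUpTo (n + 1) g =
      if g 0 = p then cylinderUpTo n (fun i => g (i + 1)) else ∅ := by
  ext ω
  split_ifs with h
  · refine ⟨fun hω i hi => hω (i + 1) (by omega), fun hω i hi => ?_⟩
    cases i with
    | zero => exact h.symm
    | succ i => exact hω i (by omega)
  · simp only [Set.mem_empty_iff_false, iff_false]
    exact fun hω => h (hω 0 (Nat.zero_le _)).symm

/-- The Markov property at time one. -/
theorem pathMeasure_eq_sum (q : PMF ℤ) (π : Policy) (x : ℤ) :
    pathMeasure q π x = Measure.sum fun z : ℤ =>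
      transition q x (π.act 0 Fin.elim0 x) z •
        (pathMeasure q (π.shift (π.pair 0 Fin.elim0 x)) z).map
          (consPath (π.pair 0 Fin.elim0 x)) := by
  set p := π.pair 0 Fin.elim0 x with hp
  have happ : ∀ s, MeasurableSet s → (Measure.sum fun z : ℤ =>
      transition q x (π.act 0 Fin.elim0 x) z •
        (pathMeasure q (π.shift p) z).map (consPath p)) s =
      ∑' z, transition q x (π.act 0 Fin.elim0 x) z *
        pathMeasure q (π.shift p) z (consPath p ⁻¹' s) := by
    intro s hs
    rw [Measure.sum_apply _ hs]
    refine tsum_congr fun z => ?_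
    rw [Measure.smul_apply, smul_eq_mul, Measure.map_apply (measurable_consPath p) hs]
  have hfin : IsFiniteMeasure (Measure.sum fun z : ℤ =>
      transition q x (π.act 0 Fin.elim0 x) z •
        (pathMeasure q (π.shift p) z).map (consPath p)) := by
    refine ⟨?_⟩
    rw [happ _ MeasurableSet.univ]
    simp [PMF.tsum_coe]
  refine measure_ext_of_cylinderUpTo fun n g => ?_
  rw [happ _ (measurableSet_cylinderUpTo n g), pathMeasure_cylinderUpTo]
  by_cases hg : g 0 = p
  · cases n with
    | zero =>
      simp [preimage_consPath_zero, hg, ← hp, PMF.tsum_coe]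
    | succ n =>
      simp only [preimage_consPath_succ, if_pos hg, pathMeasure_cylinderUpTo]
      -- The factor for the step from time `0` to `1` is split off; it equals the sum over `z` of
      -- the transition weights times the initial indicator of the shifted process.
      rw [Finset.prod_range_succ', if_pos (hp ▸ hg), one_mul]
      simp_rw [← hg, stepProb_shift, ← mul_assoc]
      rw [ENNReal.tsum_mul_right, mul_comm]
      congr 1
      unfold stepProb
      refine tsum_congr fun z => ?_
      rw [hg]
      congr 1
      refine if_congr (iff_of_eq ?_) rfl rfl
      congr 1
      unfold Policy.pair Policy.shift
      have : (Fin.cons p Fin.elim0 : Fin 1 → AdmissiblePair) = fun i : Fin (0 + 1) => g i := by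
        funext i
        obtain rfl : i = 0 := Fin.fin_one_eq_zero i
        simp [hg]
      simp only [this]
  · cases n with
    | zero => simp [preimage_consPath_zero, hg, ← hp]
    | succ n => simp [preimage_consPath_succ, hg, ← hp]

theorem lintegral_pathMeasure (q : PMF ℤ) (π : Policy) (x : ℤ)
    {f : (ℕ → AdmissiblePair) → ℝ≥0∞} (hf : Measurable f) :
    ∫⁻ ω, f ω ∂pathMeasure q π x = ∑' z : ℤ, transition q x (π.act 0 Fin.elim0 x) z *
      ∫⁻ ω, f (consPath (π.pair 0 Fin.elim0 x) ω)
        ∂pathMeasure q (π.shift (π.pair 0 Fin.elim0 x)) z := by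
  conv_lhs => rw [pathMeasure_eq_sum, lintegral_sum_measure]
  refine tsum_congr fun z => ?_
  rw [lintegral_smul_measure, lintegral_map hf (measurable_consPath _), smul_eq_mul]

theorem tsum_transition_mul (q : PMF ℤ) {x : ℤ} (hx : 0 ≤ x) (a : ℕ) (F : ℤ → ℝ≥0∞) :
    ∑' z, transition q x a z * F z = ∑' k, q k * F (x - a + k) := by
  rw [← (Equiv.addLeft (x - (a : ℤ))).tsum_eq]
  refine tsum_congr fun k => ?_
  rw [transition, if_pos hx, PMF.map_apply, tsum_eq_single k]
  · simp
  · intro j hj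
    rw [if_neg]
    simp only [Equiv.coe_addLeft]
    omega

/-! ### Dividends until ruin and the one-step recursion for policy values. -/

theorem lt_ruinTime_iff (k : ℕ) (ω : ℕ → AdmissiblePair) :
    (k : ℕ∞) < ruinTime ω ↔ ∀ i ≤ k, 0 ≤ (ω i).1.1 := by
  constructor
  · intro h i hi
    by_contra hneg
    have : ruinTime ω ≤ i := iInf₂_le (f := fun (n : ℕ) (_ : n ∈ {n : ℕ | (ω n).1.1 < 0}) => (n : ℕ∞)) i
      (not_le.1 hneg)
    exact absurd (h.trans_le this) (by simpa using hi)
  · intro h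
    have : ((k + 1 : ℕ) : ℕ∞) ≤ ruinTime ω := by
      refine le_iInf₂ fun n hn => ?_
      by_contra hlt
      have hlt' : n < k + 1 := by exact_mod_cast not_le.1 hlt
      exact absurd (h n (by omega)) (not_le.2 hn)
    exact lt_of_lt_of_le (by exact_mod_cast Nat.lt_succ_self k) this

theorem lt_ruinTime_consPath_succ {p : AdmissiblePair} (hp : 0 ≤ p.1.1) (k : ℕ)
    (ω : ℕ → AdmissiblePair) :
    ((k + 1 : ℕ) : ℕ∞) < ruinTime (consPath p ω) ↔ (k : ℕ∞) < ruinTime ω := by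
  rw [lt_ruinTime_iff, lt_ruinTime_iff]
  refine ⟨fun h i hi => h (i + 1) (by omega), fun h i hi => ?_⟩
  cases i with
  | zero => exact hp
  | succ i => exact h i (by omega)

/-- The discounted dividend paid at time `k`, if ruin has not occurred. -/
noncomputable def dividendAt (β : ℝ≥0) (k : ℕ) (ω : ℕ → AdmissiblePair) : ℝ≥0∞ :=
  if (k : ℕ∞) < ruinTime ω then (β : ℝ≥0∞) ^ k * ((ω k).1.2 : ℝ≥0∞) else 0

theorem totalDividends_eq_tsum (β : ℝ≥0) (ω : ℕ → AdmissiblePair) :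
    totalDividends β ω = ∑' k, dividendAt β k ω := rfl

theorem measurable_dividendAt (β : ℝ≥0) (k : ℕ) : Measurable (dividendAt β k) := by
  refine Measurable.ite ?_ ?_ measurable_const
  · have : {ω : ℕ → AdmissiblePair | (k : ℕ∞) < ruinTime ω} =
        ⋂ i ∈ Set.Iic k, (fun ω : ℕ → AdmissiblePair => ω i) ⁻¹' {p | 0 ≤ p.1.1} := by
      ext ω
      simp [lt_ruinTime_iff]
    rw [this]
    exact MeasurableSet.biInter (Set.to_countable _) fun i _ =>
      measurable_pi_apply i (MeasurableSet.of_discrete)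
  · exact (Measurable.of_discrete (f := fun p : AdmissiblePair =>
      (β : ℝ≥0∞) ^ k * (p.1.2 : ℝ≥0∞))).comp (measurable_pi_apply k)

theorem measurable_totalDividends (β : ℝ≥0) : Measurable (totalDividends β) :=
  Measurable.tsum fun k => measurable_dividendAt β k

theorem dividendAt_consPath_zero (β : ℝ≥0) {p : AdmissiblePair} (hp : 0 ≤ p.1.1)
    (ω : ℕ → AdmissiblePair) : dividendAt β 0 (consPath p ω) = p.1.2 := by
  rw [dividendAt, if_pos, pow_zero, one_mul]
  · rfl
  · rw [lt_ruinTime_iff]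
    intro i hi
    obtain rfl := Nat.le_zero.1 hi
    exact hp

theorem dividendAt_consPath_succ (β : ℝ≥0) {p : AdmissiblePair} (hp : 0 ≤ p.1.1) (k : ℕ)
    (ω : ℕ → AdmissiblePair) :
    dividendAt β (k + 1) (consPath p ω) = β * dividendAt β k ω := by
  unfold dividendAt
  simp only [lt_ruinTime_consPath_succ hp, mul_ite, mul_zero, pow_succ']
  refine if_congr Iff.rfl ?_ rfl
  rw [mul_assoc]
  rfl

theorem dividendAt_of_neg (β : ℝ≥0) {p : AdmissiblePair} (hp : p.1.1 < 0) (k : ℕ)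
    (ω : ℕ → AdmissiblePair) : dividendAt β k (consPath p ω) = 0 := by
  rw [dividendAt, if_neg]
  rw [lt_ruinTime_iff]
  exact fun h => absurd (h 0 (Nat.zero_le _)) (not_le.2 hp)

theorem totalDividends_consPath (β : ℝ≥0) {p : AdmissiblePair} (hp : 0 ≤ p.1.1)
    (ω : ℕ → AdmissiblePair) :
    totalDividends β (consPath p ω) = p.1.2 + β * totalDividends β ω := by
  rw [totalDividends_eq_tsum, tsum_eq_zero_add' ENNReal.summable, dividendAt_consPath_zero β hp,
    totalDividends_eq_tsum, ← ENNReal.tsum_mul_left]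
  simp_rw [dividendAt_consPath_succ β hp]

theorem totalDividends_consPath_of_neg (β : ℝ≥0) {p : AdmissiblePair} (hp : p.1.1 < 0)
    (ω : ℕ → AdmissiblePair) : totalDividends β (consPath p ω) = 0 := by
  simp [totalDividends_eq_tsum, dividendAt_of_neg β hp]

theorem measurable_rpow_totalDividends (β : ℝ≥0) (γ : ℝ) (y : ℝ≥0) :
    Measurable fun ω => (totalDividends β ω + (y : ℝ≥0∞)) ^ γ :=
  ((measurable_totalDividends β).add_const _).pow_const γ

theorem policyValue_of_neg (q : PMF ℤ) (β : ℝ≥0) (γ : ℝ) (π : Policy) {x : ℤ} (hx : x < 0)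
    (y : ℝ≥0) : policyValue q β γ π x y = (y : ℝ≥0∞) ^ γ := by
  have hp : (π.pair 0 Fin.elim0 x).1.1 < 0 := hx
  rw [policyValue, lintegral_pathMeasure q π x (measurable_rpow_totalDividends β γ y)]
  simp [totalDividends_consPath_of_neg β hp, ENNReal.tsum_mul_right, PMF.tsum_coe]

/-- If `T'` denotes the dividends after the first step, then `a + β T' + y = β (T' + (a + y)/β)`;
this homogeneity explains the factor `β^γ` and the update of `y`. -/
theorem policyValue_of_nonneg (q : PMF ℤ) {β : ℝ≥0} (hβ : 0 < β) {γ : ℝ} (hγ : 0 ≤ γ) (π : Policy)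
    {x : ℤ} (hx : 0 ≤ x) (y : ℝ≥0) :
    policyValue q β γ π x y = (β : ℝ≥0∞) ^ γ * ∑' k : ℤ,
      policyValue q β γ (π.shift (π.pair 0 Fin.elim0 x)) (x - (π.act 0 Fin.elim0 x : ℤ) + k)
        (((π.act 0 Fin.elim0 x : ℝ≥0) + y) / β) * q k := by
  have hp : 0 ≤ (π.pair 0 Fin.elim0 x).1.1 := hx
  set a := π.act 0 Fin.elim0 x with ha
  rw [policyValue, lintegral_pathMeasure q π x (measurable_rpow_totalDividends β γ y),
    tsum_transition_mul q hx, ← ENNReal.tsum_mul_left]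
  refine tsum_congr fun k => ?_
  have hpt : ∀ ω, (totalDividends β (consPath (π.pair 0 Fin.elim0 x) ω) + (y : ℝ≥0∞)) ^ γ =
      (β : ℝ≥0∞) ^ γ * (totalDividends β ω + ((((a : ℝ≥0) + y) / β : ℝ≥0) : ℝ≥0∞)) ^ γ := by
    intro ω
    rw [totalDividends_consPath β hp, ← ENNReal.mul_rpow_of_nonneg _ _ hγ, mul_add,
      ← ENNReal.coe_mul, mul_div_cancel₀ _ hβ.ne']
    congr 1
    push_cast
    rw [add_comm, ← add_assoc, add_comm (y : ℝ≥0∞), add_comm]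
    rfl
  simp_rw [hpt]
  rw [lintegral_const_mul _ (measurable_rpow_totalDividends β γ _)]
  unfold policyValue
  ring

theorem rpow_le_policyValue (q : PMF ℤ) (β : ℝ≥0) {γ : ℝ} (hγ : 0 ≤ γ) (π : Policy) (x : ℤ)
    (y : ℝ≥0) : (y : ℝ≥0∞) ^ γ ≤ policyValue q β γ π x y := by
  calc (y : ℝ≥0∞) ^ γ = ∫⁻ _, (y : ℝ≥0∞) ^ γ ∂pathMeasure q π x := by simp
    _ ≤ _ := lintegral_mono fun ω => ENNReal.rpow_le_rpow le_add_self hγ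

/-! ### First-moment bounds and finiteness of the value. -/

/-- The mean of the positive part of a random variable with law `q`. -/
noncomputable def meanPos (q : PMF ℤ) : ℝ≥0∞ := ∑' k : ℤ, q k * (k.toNat : ℝ≥0∞)

theorem toNat_sub_add_le {x : ℤ} {a : ℕ} (ha : a ∈ actions x) (k : ℤ) :
    (x - a + k).toNat ≤ (x.toNat - a) + k.toNat := by
  have : a ≤ x.toNat := by simpa [actions] using ha
  omega

theorem tsum_toNat_add_le (q : PMF ℤ) {x : ℤ} {a : ℕ} (ha : a ∈ actions x) (C : ℝ≥0∞) :
    ∑' k : ℤ, q k * (((x - a + k).toNat : ℝ≥0∞) + C) ≤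
      ((x.toNat - a : ℕ) : ℝ≥0∞) + (meanPos q + C) := by
  calc ∑' k : ℤ, q k * (((x - a + k).toNat : ℝ≥0∞) + C)
      ≤ ∑' k : ℤ, (q k * (k.toNat : ℝ≥0∞) + q k * (((x.toNat - a : ℕ) : ℝ≥0∞) + C)) := by
        refine ENNReal.tsum_le_tsum fun k => ?_
        rw [← mul_add]
        refine mul_le_mul_right ?_ _
        have h : ((x - a + k).toNat : ℝ≥0∞) ≤ ((x.toNat - a : ℕ) : ℝ≥0∞) + (k.toNat : ℝ≥0∞) := by
          exact_mod_cast toNat_sub_add_le ha k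
        calc _ ≤ ((x.toNat - a : ℕ) : ℝ≥0∞) + (k.toNat : ℝ≥0∞) + C := by gcongr
          _ = _ := by ring
    _ = _ := by
        rw [ENNReal.tsum_add, ENNReal.tsum_mul_right, PMF.tsum_coe, one_mul, meanPos]
        ring

/-- The fixed point `u = r m / (1 - r)` of `u ↦ r (m + u)` gives equality, and adding `c` preserves
the inequality since `r < 1`. -/
theorem exists_le_and_mul_add_le {r : ℝ≥0} (hr : r < 1) (m c : ℝ≥0) :
    ∃ L : ℝ≥0, c ≤ L ∧ r * (m + L) ≤ L := by
  have h1 : (0 : ℝ) < 1 - r := sub_pos.2 (by exact_mod_cast hr)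
  obtain ⟨u, hu⟩ : ∃ u : ℝ≥0, r * (m + u) = u := by
    refine ⟨⟨r * m / (1 - r), by positivity⟩, ?_⟩
    apply NNReal.coe_injective
    push_cast
    change (r : ℝ) * (m + r * m / (1 - r)) = r * m / (1 - r)
    field_simp
    ring
  refine ⟨c + u, le_self_add, ?_⟩
  calc r * (m + (c + u)) = r * c + r * (m + u) := by ring
    _ ≤ 1 * c + u := by rw [hu]; gcongr
    _ = c + u := by ring

/-- Uniform bound on the expected discounted dividends. -/
theorem lintegral_totalDividends_le (q : PMF ℤ) {β C : ℝ≥0} (hβ : β ≤ 1)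
    (hC : (β : ℝ≥0∞) * (meanPos q + C) ≤ C) (π : Policy) (x : ℤ) :
    ∫⁻ ω, totalDividends β ω ∂pathMeasure q π x ≤ (x.toNat : ℝ≥0∞) + C := by
  have hβ' : (β : ℝ≥0∞) ≤ 1 := by exact_mod_cast hβ
  -- Induction on the horizon, uniform in the policy, since the first step replaces `π` by its
  -- shift.
  have key : ∀ (N : ℕ) (π : Policy) (x : ℤ),
      ∫⁻ ω, ∑ k ∈ Finset.range N, dividendAt β k ω ∂pathMeasure q π x ≤
        (x.toNat : ℝ≥0∞) + C := by
    intro N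
    induction N with
    | zero => simp
    | succ N ih =>
      intro π x
      have hm : ∀ N, Measurable fun ω => ∑ k ∈ Finset.range N, dividendAt β k ω := fun N =>
        Finset.measurable_fun_sum _ fun k _ => measurable_dividendAt β k
      rw [lintegral_pathMeasure q π x (hm _)]
      rcases lt_or_ge x 0 with hx | hx
      · have hp : (π.pair 0 Fin.elim0 x).1.1 < 0 := hx
        simp [dividendAt_of_neg β hp]
      · have hp : 0 ≤ (π.pair 0 Fin.elim0 x).1.1 := hx
        rw [tsum_transition_mul q hx]
        have hact := π.act_mem 0 Fin.elim0 x
        set p := π.pair 0 Fin.elim0 x with hpdef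
        set a := π.act 0 Fin.elim0 x with ha
        have hax : a ≤ x.toNat := by simpa [actions] using hact
        have hint : ∀ z, ∫⁻ ω, ∑ k ∈ Finset.range (N + 1), dividendAt β k (consPath p ω)
            ∂pathMeasure q (π.shift p) z ≤ a + β * ((z.toNat : ℝ≥0∞) + C) := by
          intro z
          simp_rw [Finset.sum_range_succ', dividendAt_consPath_succ β hp,
            dividendAt_consPath_zero β hp, ← Finset.mul_sum]
          rw [lintegral_add_right _ measurable_const, lintegral_const_mul _ (hm N),
            lintegral_const, measure_univ, mul_one, add_comm]
          gcongr
          · exact le_rfl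
          · exact ih _ z
        calc _ ≤ ∑' k : ℤ, q k * ((a : ℝ≥0∞) + β * (((x - a + k).toNat : ℝ≥0∞) + C)) :=
              ENNReal.tsum_le_tsum fun k => by gcongr; exact hint _
          _ = a + β * ∑' k : ℤ, q k * (((x - a + k).toNat : ℝ≥0∞) + C) := by
              simp_rw [mul_add (q _) (a : ℝ≥0∞)]
              rw [ENNReal.tsum_add, ENNReal.tsum_mul_right, PMF.tsum_coe, one_mul,
                ← ENNReal.tsum_mul_left]
              simp_rw [mul_left_comm]
          _ ≤ a + β * (((x.toNat - a : ℕ) : ℝ≥0∞) + (meanPos q + C)) := by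
              gcongr
              exact tsum_toNat_add_le q hact C
          -- Discounting the remaining capital can be dropped, while `hC` makes `C` absorb the
          -- discounted income.
          _ ≤ a + (1 * ((x.toNat - a : ℕ) : ℝ≥0∞) + C) := by
              rw [mul_add (β : ℝ≥0∞)]
              gcongr
          _ = (x.toNat : ℝ≥0∞) + C := by
              rw [one_mul, ← add_assoc, ← Nat.cast_add, Nat.add_sub_cancel' hax]
  simp_rw [totalDividends_eq_tsum]
  rw [lintegral_tsum fun k => (measurable_dividendAt β k).aemeasurable]
  refine ENNReal.tsum_le_of_sum_range_le fun N => ?_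
  rw [← lintegral_finsetSum _ fun k _ => measurable_dividendAt β k]
  exact key N π x

theorem rpow_le_one_add (t : ℝ≥0∞) {γ : ℝ} (hγ0 : 0 ≤ γ) (hγ1 : γ ≤ 1) : t ^ γ ≤ 1 + t := by
  rcases le_total t 1 with h | h
  · exact (ENNReal.rpow_le_one h hγ0).trans le_self_add
  · calc t ^ γ ≤ t ^ (1 : ℝ) := ENNReal.rpow_le_rpow_of_exponent_le h hγ1
      _ ≤ 1 + t := by rw [ENNReal.rpow_one]; exact le_add_self

/-- Subadditivity separates `y` from the dividends, so `y` enters only through `y^γ`, the term that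
cancels in the gap estimate. -/
theorem value_le (q : PMF ℤ) {β C : ℝ≥0} (hβ : β ≤ 1) {γ : ℝ} (hγ0 : 0 ≤ γ) (hγ1 : γ ≤ 1)
    (hC : (β : ℝ≥0∞) * (meanPos q + C) ≤ C) (x : ℤ) (y : ℝ≥0) :
    value q β γ x y ≤ (y : ℝ≥0∞) ^ γ + ((x.toNat : ℝ≥0∞) + ((1 + C : ℝ≥0) : ℝ≥0∞)) := by
  refine iSup_le fun π => ?_
  calc policyValue q β γ π x y
      ≤ ∫⁻ ω, ((y : ℝ≥0∞) ^ γ + 1 + totalDividends β ω) ∂pathMeasure q π x := by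
        refine lintegral_mono fun ω => ?_
        refine (ENNReal.rpow_add_le_add_rpow _ _ hγ0 hγ1).trans ?_
        rw [add_comm, add_assoc]
        gcongr
        exact rpow_le_one_add _ hγ0 hγ1
    _ = (y : ℝ≥0∞) ^ γ + 1 + ∫⁻ ω, totalDividends β ω ∂pathMeasure q π x := by
        rw [lintegral_add_left measurable_const, lintegral_const, measure_univ, mul_one]
    _ ≤ (y : ℝ≥0∞) ^ γ + 1 + ((x.toNat : ℝ≥0∞) + C) := by
        gcongr
        exact lintegral_totalDividends_le q hβ hC π x
    _ = _ := by push_cast; ring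

/-! ### The greedy policy and the contraction of its gap. -/

/-- The Bellman inequality, with the largest maximiser as action. -/
theorem value_le_objective_largestMaximiser (q : PMF ℤ) {β : ℝ≥0} (hβ : 0 < β) {γ : ℝ}
    (hγ : 0 ≤ γ) {x : ℤ} (hx : 0 ≤ x) (y : ℝ≥0) :
    value q β γ x y ≤ objective q β γ x y (largestMaximiser q β γ x y) := by
  refine iSup_le fun π => ?_
  refine le_trans ?_ ((isGreatest_largestMaximiser q β γ hx y).1.2 _ (π.act_mem 0 Fin.elim0 x))
  rw [policyValue_of_nonneg q hβ hγ π hx y, objective, continuationValue]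
  gcongr
  exact le_iSup (fun π => policyValue q β γ π _ _) _

/-- The recursion peels off the last pair, whereas a shift prepends the first, hence the induction.
Only the state of `p` matters: the update uses the greedy action, not the one recorded in `p`. -/
theorem accumulated_cons (q : PMF ℤ) (β : ℝ≥0) (γ : ℝ) (y : ℝ≥0) (p : AdmissiblePair) (k : ℕ)
    (h : Fin k → AdmissiblePair) :
    accumulated q β γ y (k + 1) (Fin.cons p h) =
      accumulated q β γ (((largestMaximiser q β γ p.1.1 y : ℝ≥0) + y) / β) k h := by
  induction k with
  | zero =>
    simp only [accumulated]
    rw [add_comm]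
    rfl
  | succ k ih =>
    have hcast : (fun i : Fin (k + 1) => (Fin.cons p h : Fin (k + 2) → AdmissiblePair) i.castSucc) =
        (Fin.cons p fun i : Fin k => h i.castSucc) := by
      funext i
      refine Fin.cases ?_ (fun j => ?_) i
      · rfl
      · rw [← Fin.succ_castSucc, Fin.cons_succ, Fin.cons_succ]
    have hlast : (Fin.cons p h : Fin (k + 2) → AdmissiblePair) (Fin.last (k + 1)) =
        h (Fin.last k) := by
      rw [← Fin.succ_last, Fin.cons_succ]
    rw [accumulated, hcast, hlast, ih, accumulated]

theorem optimalPolicy_shift (q : PMF ℤ) (β : ℝ≥0) (γ : ℝ) (y : ℝ≥0) (p : AdmissiblePair) :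
    (optimalPolicy q β γ y).shift p =
      optimalPolicy q β γ (((largestMaximiser q β γ p.1.1 y : ℝ≥0) + y) / β) := by
  unfold optimalPolicy Policy.shift
  simp only [accumulated_cons]

theorem policyValue_optimalPolicy (q : PMF ℤ) {β : ℝ≥0} (hβ : 0 < β) {γ : ℝ} (hγ : 0 ≤ γ)
    {x : ℤ} (hx : 0 ≤ x) (y : ℝ≥0) :
    policyValue q β γ (optimalPolicy q β γ y) x y = (β : ℝ≥0∞) ^ γ * ∑' k : ℤ,
      policyValue q β γ
        (optimalPolicy q β γ (((largestMaximiser q β γ x y : ℝ≥0) + y) / β))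
        (x - (largestMaximiser q β γ x y : ℤ) + k)
        (((largestMaximiser q β γ x y : ℝ≥0) + y) / β) * q k := by
  rw [policyValue_of_nonneg q hβ hγ _ hx y, optimalPolicy_shift]
  rfl

/-- The gap between the value and the value of the greedy policy is contracted. -/
theorem value_le_policyValue_add (q : PMF ℤ) {β r L : ℝ≥0} (hβ : 0 < β) {γ : ℝ} (hγ : 0 ≤ γ)
    (hr : (β : ℝ≥0∞) ^ γ ≤ r) (hL : (β : ℝ≥0∞) ^ γ * (meanPos q + L) ≤ r * L)
    (hbase : ∀ x y, value q β γ x y ≤ (y : ℝ≥0∞) ^ γ + ((x.toNat : ℝ≥0∞) + L))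
    (n : ℕ) (x : ℤ) (y : ℝ≥0) :
    value q β γ x y ≤ policyValue q β γ (optimalPolicy q β γ y) x y +
      (r : ℝ≥0∞) ^ n * ((x.toNat : ℝ≥0∞) + L) := by
  induction n generalizing x y with
  | zero =>
    refine (hbase x y).trans ?_
    -- The lower bound `y^γ` for the greedy value matches the `y^γ` in `hbase`.
    rw [pow_zero, one_mul]
    gcongr
    exact rpow_le_policyValue q β hγ _ x y
  | succ n ih =>
    rcases lt_or_ge x 0 with hx | hx
    -- After ruin every policy has value `y^γ`, so there is no gap.
    · refine le_trans ?_ le_self_add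
      refine iSup_le fun π => ?_
      rw [policyValue_of_neg q β γ π hx, policyValue_of_neg q β γ _ hx]
    · refine (value_le_objective_largestMaximiser q hβ hγ hx y).trans ?_
      rw [policyValue_optimalPolicy q hβ hγ hx y, objective, continuationValue]
      have hact := largestMaximiser_mem q β γ x y
      set a := largestMaximiser q β γ x y
      calc _ ≤ (β : ℝ≥0∞) ^ γ * ∑' k : ℤ, (policyValue q β γ
              (optimalPolicy q β γ (((a : ℝ≥0) + y) / β)) (x - (a : ℤ) + k)
                (((a : ℝ≥0) + y) / β) * q k +
              (r : ℝ≥0∞) ^ n * (q k * (((x - a + k).toNat : ℝ≥0∞) + L))) := by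
            gcongr with k
            refine (mul_le_mul_left (ih _ _) _).trans (le_of_eq ?_)
            ring
        _ = (β : ℝ≥0∞) ^ γ * ∑' k : ℤ, policyValue q β γ
              (optimalPolicy q β γ (((a : ℝ≥0) + y) / β)) (x - (a : ℤ) + k)
                (((a : ℝ≥0) + y) / β) * q k + (r : ℝ≥0∞) ^ n * ((β : ℝ≥0∞) ^ γ *
              ∑' k : ℤ, q k * (((x - a + k).toNat : ℝ≥0∞) + L)) := by
            rw [ENNReal.tsum_add, ENNReal.tsum_mul_left]
            ring
        _ ≤ _ := by
            rw [pow_succ, mul_assoc (_ ^ n)]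
            refine add_le_add_right (mul_le_mul_right ?_ _) _
            calc _ ≤ (β : ℝ≥0∞) ^ γ * (((x.toNat - a : ℕ) : ℝ≥0∞) + (meanPos q + L)) := by
                  gcongr
                  exact tsum_toNat_add_le q hact L
              _ ≤ r * (x.toNat : ℝ≥0∞) + r * L := by
                  rw [mul_add]
                  gcongr
                  exact Nat.sub_le _ _
              _ = _ := by rw [mul_add]

end Dividend

theorem mainTheorem8 (q : PMF ℤ) (β : ℝ≥0) (γ : ℝ)
    (hβ0 : 0 < β) (hβ1 : β < 1) (hγ0 : 0 < γ) (hγ1 : γ < 1)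
    (hA1 : ∑' k : ℤ, q k * ((max k 0).toNat : ℝ≥0∞) < ∞)
    (hA2 : 0 < q.toMeasure (Set.Iio (0 : ℤ)))
    (x : ℤ) (y : ℝ≥0) :
    Dividend.value q β γ x y =
        Dividend.policyValue q β γ (Dividend.optimalPolicy q β γ y) x y ∧
      Dividend.value q β γ x y < ∞ := by
  have hmean : Dividend.meanPos q < ∞ := by
    refine lt_of_eq_of_lt (tsum_congr fun k => ?_) hA1
    congr 2
    omega
  obtain ⟨m, hm⟩ := ENNReal.lt_iff_exists_coe.1 hmean |>.imp fun _ h => h.1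
  obtain ⟨C, -, hC⟩ := Dividend.exists_le_and_mul_add_le hβ1 m 0
  have hbase := Dividend.value_le q (C := C) hβ1.le hγ0.le hγ1.le
    (by rw [hm]; exact_mod_cast hC)
  have hb1 : β ^ γ < 1 := NNReal.rpow_lt_one hβ1 hγ0
  obtain ⟨r, hbr, hr1⟩ := exists_between hb1
  have hr0 : 0 < r := lt_of_le_of_lt zero_le hbr
  -- The slack between `β^γ` and `r` pays for the mean income `m`: the ratio `β^γ / r` is below `1`,
  -- so a suitable `L` exists.
  obtain ⟨L, hCL, hL⟩ := Dividend.exists_le_and_mul_add_le ((div_lt_one hr0).2 hbr) m (1 + C)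
  have hL' : β ^ γ * (m + L) ≤ r * L := by
    calc β ^ γ * (m + L) = r * (β ^ γ / r * (m + L)) := by field_simp
      _ ≤ r * L := by gcongr
  have hpow : (β : ℝ≥0∞) ^ γ = ((β ^ γ : ℝ≥0) : ℝ≥0∞) :=
    ENNReal.coe_rpow_of_nonneg _ hγ0.le |>.symm
  have hgap := fun n => Dividend.value_le_policyValue_add q (r := r) (L := L) hβ0 hγ0.le
    (by rw [hpow]; exact_mod_cast hbr.le) (by rw [hpow, hm]; exact_mod_cast hL')
    (fun x y => (hbase x y).trans (by gcongr)) n x y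
  refine ⟨le_antisymm ?_ (le_iSup (fun π => Dividend.policyValue q β γ π x y) _), ?_⟩
  · have hlim : Filter.Tendsto (fun n : ℕ =>
        Dividend.policyValue q β γ (Dividend.optimalPolicy q β γ y) x y +
          (r : ℝ≥0∞) ^ n * ((x.toNat : ℝ≥0∞) + L)) Filter.atTop
        (nhds (Dividend.policyValue q β γ (Dividend.optimalPolicy q β γ y) x y +
          0 * ((x.toNat : ℝ≥0∞) + L))) := by
      -- Finiteness of `x⁺ + L` makes multiplication continuous at the limit `0`.
      refine Filter.Tendsto.const_add _ (ENNReal.Tendsto.mul_const ?_ (Or.inr (by simp)))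
      exact ENNReal.tendsto_pow_atTop_nhds_zero_of_lt_one (by exact_mod_cast hr1)
    rw [zero_mul, add_zero] at hlim
    exact ge_of_tendsto' hlim hgap
  · refine (hbase x y).trans_lt ?_
    rw [← ENNReal.coe_rpow_of_nonneg _ hγ0.le]
    simp [ENNReal.add_lt_top]
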